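/- Let $R$ be an associative unital ring. An idempotent $e\in R$ is \emph{local} if the ring $\mathrm{End}_R(eR)\cong eRe$ is local. Assume that $R$ is semiperfect, i.e. $1_R$ is a sum $e_1+\dots+e_m$ of finitely many pairwise orthogonal local idempotents; the left ideals $Re$ with $e$ a local idempotent are called primitive left ideals. Write $\mathrm{soc}(M)$ for the sum of all simple submodules of a module $M$ and $\mathrm{top}(M)$ for the quotient of $M$ by the intersection of its maximal submodules (so that $\mathrm{top}(R_R)$ and $\mathrm{top}({}_RR)$ are $R/J(R)$, with $J(R)$ the Jacobson radical), and put $S_r=\mathrm{soc}(R_R)$, $S_l=\mathrm{soc}({}_RR)$. Reorder the $e_j$ so that $e_1R,\dots,e_nR$ is a list, without repetition, of representatives of the isomorphism classes of the right ideals $e_jR$, $1\le j\le m$ (a basic set of idempotents), and let $\mu_k$ be the number of $j\le m$ with $e_jR\cong e_kR$. A permutation $\pi$ of $\{1,\dots,n\}$ is a \emph{Nakayama permutation} of $R$ if for all $k\le n$ $$\mathrm{soc}(e_kR)\cong \mathrm{top}(e_{\pi(k)}R)\ \text{ as right modules},\qquad \mathrm{soc}(Re_{\pi(k)})\cong \mathrm{top}(Re_k)\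 \text{ as left modules},$$ and it \emph{respects multiplicities} if $\mu_k=\mu_{\pi(k)}$ for all $k\le n$. \textbf{Proposition.} Suppose that $S_r$ is an essential right ideal (it meets every nonzero right ideal nontrivially) and that every primitive left ideal has a nonzero socle. If $S_l\cong\mathrm{top}({}_RR)$ as left $R$-modules and $S_r\cong\mathrm{top}(R_R)$ as right $R$-modules, then, for every choice of a complete family $e_1,\dots,e_m$ and a basic set as above, $R$ has a Nakayama permutation that respects multiplicities. -/

import Mathlib

/-! Left modules over `R` are `R`-modules; right modules over `R` are `Rᵐᵒᵖ`-modules.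
In particular `Submodule R R` are the left ideals and `Submodule Rᵐᵒᵖ R` the right ideals. -/

namespace NakayamaPerm

open MulOpposite

section Modules

variable (S : Type*) [Ring S] (M : Type*) [AddCommGroup M] [Module S M]

/-- The socle of a module: the sum of all its simple submodules. -/
def socle : Submodule S M :=
  sSup {N : Submodule S M | IsSimpleModule S N}

/-- The top of a module: the quotient by its radical, which is the intersection of all maximal
submodules. For `M = S` this is `S / J(S)`. -/
abbrev Top : Type _ := M ⧸ Module.jacobson S M

variable {S M}

/-- A submodule is essential if it meets every nonzero submodule nontrivially. -/
def IsEssential (N : Submodule S M) : Prop :=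
  ∀ L : Submodule S M, L ≠ ⊥ → N ⊓ L ≠ ⊥

end Modules

section Rings

variable {R : Type*} [Ring R]

/-- The principal right ideal `eR`. -/
abbrev rightIdeal (e : R) : Submodule Rᵐᵒᵖ R := Submodule.span Rᵐᵒᵖ {e}

/-- The principal left ideal `Re`. -/
abbrev leftIdeal (e : R) : Submodule R R := Submodule.span R {e}

/-- A local idempotent: an idempotent `e` such that the ring `End(eR_R)` is local. -/
structure IsLocalIdempotent (e : R) : Prop where
  idem : IsIdempotentElem e
  isLocalRing_end : IsLocalRing (Module.End Rᵐᵒᵖ (rightIdeal e))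

variable (R) in
/-- A ring is semiperfect if its unity is a sum of finitely many pairwise orthogonal local
idempotents. -/
def IsSemiperfect : Prop :=
  ∃ (m : ℕ) (e : Fin m → R), CompleteOrthogonalIdempotents e ∧ ∀ i, IsLocalIdempotent (e i)

variable (R) in
/-- A complete family `e₁, …, eₘ` of pairwise orthogonal local idempotents, together with a choice
of `n` of its members, the *basic set of idempotents*, whose right ideals represent each
isomorphism class of the right ideals `eⱼR` exactly once. -/
structure BasicIdempotents (m n : ℕ) where
  /-- The complete family of pairwise orthogonal local idempotents. -/
  e : Fin m → R
  complete : CompleteOrthogonalIdempotents e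
  isLocal : ∀ j, IsLocalIdempotent (e j)
  /-- The positions of the basic idempotents in the family. -/
  idx : Fin n → Fin m
  irredundant : ∀ k l,
    Nonempty (rightIdeal (e (idx k)) ≃ₗ[Rᵐᵒᵖ] rightIdeal (e (idx l))) → k = l
  exhaustive : ∀ j, ∃ k, Nonempty (rightIdeal (e (idx k)) ≃ₗ[Rᵐᵒᵖ] rightIdeal (e j))

namespace BasicIdempotents

variable {m n : ℕ} (B : BasicIdempotents R m n)

/-- The `k`-th basic idempotent. -/
def basic (k : Fin n) : R := B.e (B.idx k)

/-- The multiplicity `μₖ`: the number of indices `j` with `eₖR ≅ eⱼR`. -/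
noncomputable def mult (k : Fin n) : ℕ :=
  Nat.card {j : Fin m // Nonempty (rightIdeal (B.basic k) ≃ₗ[Rᵐᵒᵖ] rightIdeal (B.e j))}

/-- `π` is a Nakayama permutation: `soc(eₖR) ≅ top(e_{π(k)}R)` as right modules and
`soc(Re_{π(k)}) ≅ top(Reₖ)` as left modules, for all `k`. -/
def IsNakayamaPermutation (π : Equiv.Perm (Fin n)) : Prop :=
  ∀ k,
    Nonempty (socle Rᵐᵒᵖ (rightIdeal (B.basic k)) ≃ₗ[Rᵐᵒᵖ]
      Top Rᵐᵒᵖ (rightIdeal (B.basic (π k)))) ∧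
    Nonempty (socle R (leftIdeal (B.basic (π k))) ≃ₗ[R]
      Top R (leftIdeal (B.basic k)))

/-- `π` respects the multiplicities. -/
def RespectsMultiplicities (π : Equiv.Perm (Fin n)) : Prop :=
  ∀ k, B.mult k = B.mult (π k)

end BasicIdempotents

variable (R) in
/-- `R` has a Nakayama permutation respecting multiplicities: `R` has a basic set of idempotents,
and for every choice of one there is such a permutation. -/
def HasNakayamaPermutationRespectingMultiplicities : Prop :=
  (∃ m n : ℕ, Nonempty (BasicIdempotents R m n)) ∧
  ∀ (m n : ℕ) (B : BasicIdempotents R m n), ∃ π : Equiv.Perm (Fin n),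
    B.IsNakayamaPermutation π ∧ B.RespectsMultiplicities π

end Rings

end NakayamaPerm

namespace NakayamaPerm

open MulOpposite

/-! ### Socles, tops and multiplicities of simple modules -/

section Modules

variable {S M N : Type*} [Ring S] [AddCommGroup M] [Module S M] [AddCommGroup N] [Module S N]

/-! Along `1 = ∑ eⱼ` the socle and the top of `R_R` split as sums of the `soc(eⱼR)` and of the
`top(eⱼR)`. The tops are simple by locality, and the socles are nonzero by essentiality. Since both
sums have length `m`, every `soc(eⱼR)` is simple (`isSimpleModule_of_pi_equiv`), hence the top of a
unique basic right ideal, which defines a map `σ` on basic indices. Counting a simple module on both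
sides (`card_iso_eq_of_pi_equiv`) shows that the `j` with `soc(eⱼR) ≅ top(eₗR)` number `μₗ > 0`. So
`σ` is onto, hence a permutation `π`, and `μ` is preserved.

For the left modules, the same length count makes `soc(Re_{π(k)})` simple, so it suffices that `eₖ`
does not annihilate it. As `S_l ≅ R/J(R)`, `eₖS_l` is a nonzero right ideal, hence meets `S_r` and
contains the simple module `soc(eₖR)`. Since `soc(eₖR) ≅ top(e_{π(k)}R)`, some `t` in it has `t
e_{π(k)} ≠ 0`, and this product is the required element, fixed by `eₖ`.

Right modules are treated as left modules over `Rᵐᵒᵖ`. -/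

theorem map_socle_le (f : M →ₗ[S] N) : (socle S M).map f ≤ socle S N := by
  rw [Submodule.map_le_iff_le_comap]
  refine sSup_le fun L hL => ?_
  have : IsSimpleModule S L := hL
  rw [← Submodule.map_le_iff_le_comap]
  have hrange : LinearMap.range (f.domRestrict L) = L.map f := by
    rw [LinearMap.domRestrict, LinearMap.range_comp, Submodule.range_subtype]
  rcases LinearMap.injective_or_eq_zero (f.domRestrict L) with h | h
  · refine le_sSup ?_
    rw [Set.mem_ofPred_eq, ← hrange]
    exact IsSimpleModule.congr (LinearEquiv.ofInjective _ h).symm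
  · rw [← hrange, h, LinearMap.range_zero]
    exact bot_le

theorem map_mem_socle (f : M →ₗ[S] N) {x : M} (hx : x ∈ socle S M) : f x ∈ socle S N :=
  map_socle_le f (Submodule.mem_map_of_mem hx)

instance isSemisimpleModule_socle : IsSemisimpleModule S (socle S M) := by
  unfold socle
  rw [sSup_eq_iSup]
  exact isSemisimpleModule_biSup_of_isSemisimpleModule_submodule fun L hL => by
    have : IsSimpleModule S L := hL
    infer_instance

theorem le_socle_of_isSemisimpleModule (L : Submodule S M) [IsSemisimpleModule S L] :
    L ≤ socle S M := by
  have h : socle S L = ⊤ := IsSemisimpleModule.sSup_simples_eq_top S L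
  have h' := map_socle_le L.subtype
  rwa [h, Submodule.map_subtype_top] at h'

/-- The socle of a submodule `L` is the intersection of `L` with the socle. -/
theorem mem_socle_submodule_iff {L : Submodule S M} {x : L} :
    x ∈ socle S L ↔ (x : M) ∈ socle S M := by
  refine ⟨map_mem_socle L.subtype, fun hx => ?_⟩
  let K : Submodule S L := (socle S M).comap L.subtype
  have : IsSemisimpleModule S K :=
    IsSemisimpleModule.of_injective ((L.subtype.domRestrict K).codRestrict (socle S M)
      fun y => y.2) fun y z h =>
        Subtype.ext (Subtype.ext (congrArg (fun w : socle S M => (w : M)) h))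
  exact le_socle_of_isSemisimpleModule K hx

theorem map_socle_equiv (f : M ≃ₗ[S] N) : (socle S M).map (f : M →ₗ[S] N) = socle S N := by
  refine le_antisymm (map_socle_le _) fun x hx =>
    ⟨f.symm x, map_mem_socle f.symm.toLinearMap hx, ?_⟩
  simp

/-- Isomorphic modules have isomorphic socles. -/
def socleEquiv (f : M ≃ₗ[S] N) : socle S M ≃ₗ[S] socle S N :=
  f.submoduleMap _ |>.trans (LinearEquiv.ofEq _ _ (map_socle_equiv f))

/-- Isomorphic modules have isomorphic tops. -/
def topEquiv (f : M ≃ₗ[S] N) : Top S M ≃ₗ[S] Top S N :=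
  Submodule.Quotient.equiv _ _ f (Module.map_jacobson_of_bijective f.bijective)

section Pi

variable {ι : Type*} [Fintype ι] [DecidableEq ι] (P : ι → Type*) [∀ i, AddCommGroup (P i)]
  [∀ i, Module S (P i)]

/-- The socle of a finite product is the product of the socles. -/
def soclePiEquiv : socle S (Π i, P i) ≃ₗ[S] Π i, socle S (P i) where
  toFun x i := ⟨(x : Π i, P i) i, map_mem_socle (LinearMap.proj i) x.2⟩
  map_add' _ _ := rfl
  map_smul' _ _ := rfl
  invFun y := ⟨fun i => y i, by
    rw [← Finset.univ_sum_single (fun i => (y i : P i))]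
    exact Submodule.sum_mem _ fun i _ => map_mem_socle (LinearMap.single S P i) (y i).2⟩
  left_inv _ := rfl
  right_inv _ := rfl

theorem jacobson_pi :
    Module.jacobson S (Π i, P i) = Submodule.pi Set.univ (fun i => Module.jacobson S (P i)) := by
  refine le_antisymm (Module.jacobson_pi_le S P) fun x hx => ?_
  rw [← Finset.univ_sum_single x]
  exact Submodule.sum_mem _ fun i _ =>
    Module.map_jacobson_le (LinearMap.single S P i)
      (Submodule.mem_map_of_mem (hx i (Set.mem_univ i)))

/-- The top of a finite product is the product of the tops. -/
noncomputable def topPiEquiv : Top S (Π i, P i) ≃ₗ[S] Π i, Top S (P i) :=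
  (Submodule.quotEquivOfEq _ _ (by
    ext x
    simp [jacobson_pi, Submodule.mem_pi, funext_iff])).trans
  (LinearMap.quotKerEquivOfSurjective
    (LinearMap.pi fun i => (Module.jacobson S (P i)).mkQ ∘ₗ LinearMap.proj i) fun y =>
      ⟨fun i => (Submodule.mkQ_surjective _ (y i)).choose, funext fun i =>
        (Submodule.mkQ_surjective _ (y i)).choose_spec⟩)

end Pi

/-- If a finite product of nonzero modules is isomorphic to a product of simple modules over the
same index type, then its factors are simple. -/
theorem isSimpleModule_of_pi_equiv {ι : Type*} [Fintype ι] {A T : ι → Type*}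
    [∀ i, AddCommGroup (A i)] [∀ i, Module S (A i)] [∀ i, AddCommGroup (T i)]
    [∀ i, Module S (T i)] [∀ i, Nontrivial (A i)] [∀ i, IsSimpleModule S (T i)]
    (f : (Π i, A i) ≃ₗ[S] Π i, T i) (i : ι) : IsSimpleModule S (A i) := by
  have hlen := f.length_eq
  simp only [Module.length_pi_of_fintype, Module.length_eq_one] at hlen
  have hpos : ∀ j, 1 ≤ Module.length S (A j) := fun j =>
    Order.one_le_iff_pos.mpr Module.length_pos
  -- Finiteness allows the comparison of sums to take place in `ℕ`, where cancellation holds.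
  have hne : ∀ j, Module.length S (A j) ≠ ⊤ := fun j hj => by
    have h1 : Module.length S (A j) ≤ ∑ j, Module.length S (A j) :=
      Finset.single_le_sum (f := fun j => Module.length S (A j)) (fun _ _ => bot_le)
        (Finset.mem_univ j)
    rw [hj, hlen, top_le_iff] at h1
    simp at h1
  rw [← Module.length_eq_one_iff]
  choose a ha using fun j => ENat.ne_top_iff_exists.mp (hne j)
  simp only [← ha] at hlen hpos ⊢
  have hlen' : ∑ j, a j = ∑ _j : ι, 1 := by exact_mod_cast hlen
  have hpos' : ∀ j ∈ Finset.univ, 1 ≤ a j := fun j _ => by exact_mod_cast hpos j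
  exact_mod_cast ((Finset.sum_eq_sum_iff_of_le hpos').mp hlen'.symm i (Finset.mem_univ i)).symm

/-- Precomposition with an isomorphism, as a map of modules over the endomorphism ring of the
target. -/
def homCongrLeft {M' : Type*} [AddCommGroup M'] [Module S M'] (f : M ≃ₗ[S] M') :
    (M →ₗ[S] N) ≃ₗ[Module.End S N] (M' →ₗ[S] N) where
  toFun φ := φ ∘ₗ f.symm.toLinearMap
  invFun φ := φ ∘ₗ f.toLinearMap
  map_add' _ _ := rfl
  map_smul' _ _ := rfl
  left_inv φ := by ext; simp
  right_inv φ := by ext; simp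

open scoped Classical in
/-- The dimension of `Hom(A, T)` over `End(T)` for simple modules `A` and `T`. -/
theorem length_hom_of_isSimpleModule [IsSimpleModule S M] [IsSimpleModule S N] :
    Module.length (Module.End S N) (M →ₗ[S] N) = if Nonempty (M ≃ₗ[S] N) then 1 else 0 := by
  split_ifs with h
  · obtain ⟨f⟩ := h
    rw [(homCongrLeft f).length_eq]
    let _ : DivisionRing (Module.End S N) := Module.End.instDivisionRing
    exact Module.length_eq_one (Module.End S N) (Module.End S N)
  · have : Subsingleton (M →ₗ[S] N) := ⟨fun φ ψ => by
      have key : ∀ φ : M →ₗ[S] N, φ = 0 := fun φ =>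
        (LinearMap.bijective_or_eq_zero φ).resolve_left
          fun hb => h ⟨LinearEquiv.ofBijective φ hb⟩
      rw [key φ, key ψ]⟩
    exact Module.length_eq_zero

/-- By Schur's lemma each factor contributes 1 or 0, so the multiplicity of `N` becomes an
isomorphism invariant of the product. -/
theorem length_pi_hom_eq_card {ι : Type*} [Fintype ι] (B : ι → Type*) [∀ i, AddCommGroup (B i)]
    [∀ i, Module S (B i)] [∀ i, IsSimpleModule S (B i)] [IsSimpleModule S N] :
    Module.length (Module.End S N) ((Π i, B i) →ₗ[S] N) =
      (Nat.card {i // Nonempty (B i ≃ₗ[S] N)} : ℕ∞) := by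
  classical
  rw [← (LinearMap.lsum S B (Module.End S N) (M := N)).length_eq, Module.length_pi_of_fintype]
  simp [length_hom_of_isSimpleModule, Fintype.card_subtype]

/-- Multiplicities of simple modules in a finite product are determined by the product. -/
theorem card_iso_eq_of_pi_equiv {ι : Type*} [Fintype ι] {A T : ι → Type*}
    [∀ i, AddCommGroup (A i)] [∀ i, Module S (A i)] [∀ i, AddCommGroup (T i)]
    [∀ i, Module S (T i)] [∀ i, IsSimpleModule S (A i)] [∀ i, IsSimpleModule S (T i)]
    (f : (Π i, A i) ≃ₗ[S] Π i, T i) [IsSimpleModule S N] :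
    Nat.card {i // Nonempty (A i ≃ₗ[S] N)} = Nat.card {i // Nonempty (T i ≃ₗ[S] N)} := by
  have h := (homCongrLeft (N := N) f).length_eq
  rw [length_pi_hom_eq_card, length_pi_hom_eq_card] at h
  exact_mod_cast h

end Modules
-- Local idempotents and the modules they generate
section Idempotents

variable {S M : Type*} [Ring S] [AddCommGroup M] [Module S M] {e f : S}

/-- An idempotent `e` whose corner ring `eSe` is local, in terms of elements. -/
structure IsCornerLocal (e : S) : Prop where
  idem : e * e = e
  ne_zero : e ≠ 0
  exists_inv : ∀ x y, e * x = x → x * e = x → e * y = y → y * e = y → x + y = e →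
    (∃ z, z * x = e ∧ x * z = e) ∨ ∃ z, z * y = e ∧ y * z = e

theorem mem_leftIdeal (he : e * e = e) {x : S} : x ∈ leftIdeal e ↔ x * e = x := by
  rw [leftIdeal, Submodule.mem_span_singleton]
  refine ⟨?_, fun h => ⟨x, h⟩⟩
  rintro ⟨a, rfl⟩
  rw [smul_eq_mul, mul_assoc, he]

theorem self_mem_leftIdeal (e : S) : e ∈ leftIdeal e := Submodule.mem_span_singleton_self e

/-- The map `Se → M` sending `e` to `t`, when `e • t = t`. -/
def ofGenerator (e : S) (t : M) : leftIdeal e →ₗ[S] M :=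
  (LinearMap.toSpanSingleton S M t).domRestrict (leftIdeal e)

@[simp]
theorem ofGenerator_apply (t : M) (x : leftIdeal e) : ofGenerator e t x = (x : S) • t := rfl

/-- Right multiplication by `x ∈ eSf` as a map `Se → Sf`. -/
def mulRight (he : f * f = f) (x : S) (hx : x * f = x) : leftIdeal e →ₗ[S] leftIdeal f :=
  ofGenerator e ⟨x, (mem_leftIdeal he).mpr hx⟩

@[simp]
theorem coe_mulRight (he : f * f = f) (x : S) (hx : x * f = x) (r : leftIdeal e) :
    (mulRight he x hx r : S) = r * x := rfl

theorem exists_inv_of_isUnit_mulRight (he : e * e = e) {x : S} (hex : e * x = x) (hxe : x * e = x)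
    (h : IsUnit (mulRight (e := e) he x hxe)) : ∃ z, z * x = e ∧ x * z = e := by
  rw [Module.End.isUnit_iff] at h
  obtain ⟨z, hz⟩ := h.2 ⟨e, self_mem_leftIdeal e⟩
  have hz' : (z : S) * x = e := congrArg Subtype.val hz
  have hze : (z : S) * e = z := (mem_leftIdeal he).mp z.2
  refine ⟨z, hz', ?_⟩
  have h1 : (⟨x * z, (mem_leftIdeal he).mpr (by rw [mul_assoc, hze])⟩ : leftIdeal e) =
      ⟨e, self_mem_leftIdeal e⟩ := h.1 (Subtype.ext (by
    simp only [coe_mulRight]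
    rw [mul_assoc, hz', hxe, hex]))
  exact congrArg Subtype.val h1

theorem IsCornerLocal.of_isLocalRing_end (he : e * e = e)
    (h : IsLocalRing (Module.End S (leftIdeal e))) : IsCornerLocal e where
  idem := he
  ne_zero := by
    rintro rfl
    obtain ⟨φ, ψ, hne⟩ := exists_pair_ne (Module.End S (leftIdeal (0 : S)))
    refine hne (LinearMap.ext fun x => ?_)
    have hx : x = 0 := Subtype.ext (by simpa using ((mem_leftIdeal he).mp x.2).symm)
    rw [hx, map_zero, map_zero]
  exists_inv x y hex hxe hey hye hxy := by
    have hadd : mulRight (e := e) he x hxe + mulRight he y hye = 1 := by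
      ext r
      simp [← mul_add, hxy, (mem_leftIdeal he).mp r.2]
    exact (h.isUnit_or_isUnit_of_add_one hadd).imp (exists_inv_of_isUnit_mulRight he hex hxe)
      (exists_inv_of_isUnit_mulRight he hey hye)

/-- The elementwise condition is left-right symmetric, so locality of `End(eR)` also governs `Re`.
-/
theorem IsCornerLocal.of_op {e : S} (h : IsCornerLocal (op e)) : IsCornerLocal e where
  idem := op_injective h.idem
  ne_zero := fun h0 => h.ne_zero (by rw [h0, op_zero])
  exists_inv x y hex hxe hey hye hxy := by
    have h1 := h.exists_inv (op x) (op y) (unop_injective hxe) (unop_injective hex)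
      (unop_injective hye) (unop_injective hey) (unop_injective hxy)
    refine h1.imp ?_ ?_ <;>
    · rintro ⟨z, h2, h3⟩
      exact ⟨unop z, op_injective h3, op_injective h2⟩

namespace IsCornerLocal

variable (he : IsCornerLocal e)
include he

theorem exists_isCoatom : ∃ N : Submodule S (leftIdeal e), IsCoatom N := by
  have : Nontrivial (leftIdeal e) :=
    ⟨⟨e, self_mem_leftIdeal e⟩, 0, fun h => he.ne_zero (congrArg Subtype.val h)⟩
  have : Module.Finite S (leftIdeal e) := Module.Finite.span_singleton S e
  obtain ⟨N, hN, -⟩ := (eq_top_or_exists_le_coatom (⊥ : Submodule S (leftIdeal e))).resolve_left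
    bot_ne_top
  exact ⟨N, hN⟩

theorem eq_top_of_mul_eq {N : Submodule S (leftIdeal e)} {x : leftIdeal e} (hx : x ∈ N) {z : S}
    (hz : z * x = e) : N = ⊤ := by
  refine eq_top_iff.mpr fun r _ => ?_
  have hr : r = ((r : S) * z) • x := Subtype.ext (by
    simp [mul_assoc, hz, (mem_leftIdeal he.idem).mp r.2])
  rw [hr]
  exact N.smul_mem _ hx

/-- Two distinct maximal submodules would give `e = x + y` with one summand in each. One of `ex`,
`ey` is then invertible in the corner, which puts `e` in a proper submodule. -/
theorem coatom_unique {N N' : Submodule S (leftIdeal e)} (hN : IsCoatom N) (hN' : IsCoatom N') :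
    N = N' := by
  by_contra hne
  have hsup : N ⊔ N' = ⊤ := hN.sup_eq_top_of_ne hN' hne
  have hmem : (⟨e, self_mem_leftIdeal e⟩ : leftIdeal e) ∈ N ⊔ N' := by rw [hsup]; trivial
  obtain ⟨x, hx, y, hy, hxy⟩ := Submodule.mem_sup.mp hmem
  have hxy' : (x : S) + y = e := congrArg Subtype.val hxy
  have hxe := (mem_leftIdeal he.idem).mp x.2
  have hye := (mem_leftIdeal he.idem).mp y.2
  rcases he.exists_inv (e * x) (e * y) (by rw [← mul_assoc, he.idem]) (by rw [mul_assoc, hxe])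
    (by rw [← mul_assoc, he.idem]) (by rw [mul_assoc, hye])
    (by rw [← mul_add, hxy', he.idem]) with ⟨z, hz, -⟩ | ⟨z, hz, -⟩
  · exact hN.1 (he.eq_top_of_mul_eq hx (z := z * e) (by rw [mul_assoc, hz]))
  · exact hN'.1 (he.eq_top_of_mul_eq hy (z := z * e) (by rw [mul_assoc, hz]))

theorem jacobson_eq {N : Submodule S (leftIdeal e)} (hN : IsCoatom N) :
    Module.jacobson S (leftIdeal e) = N :=
  le_antisymm (sInf_le hN) (le_sInf fun _ hN' => (he.coatom_unique hN hN').le)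

theorem isCoatom_jacobson : IsCoatom (Module.jacobson S (leftIdeal e)) := by
  obtain ⟨N, hN⟩ := he.exists_isCoatom
  rwa [he.jacobson_eq hN]

theorem isSimpleModule_top : IsSimpleModule S (Top S (leftIdeal e)) :=
  isSimpleModule_iff_isCoatom.mpr he.isCoatom_jacobson

/-- A simple module `M` with `eM ≠ 0` is isomorphic to the top of `Se`. -/
theorem nonempty_equiv_top [IsSimpleModule S M] {t : M} (ht : e • t ≠ 0) :
    Nonempty (M ≃ₗ[S] Top S (leftIdeal e)) := by
  have hne : ofGenerator e t ≠ 0 := fun h =>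
    ht (by simpa using LinearMap.congr_fun h ⟨e, self_mem_leftIdeal e⟩)
  have hsurj := LinearMap.surjective_of_ne_zero hne
  have hker := LinearMap.isCoatom_ker_of_surjective hsurj
  exact ⟨((Submodule.quotEquivOfEq _ _ (he.jacobson_eq hker)).trans
    (LinearMap.quotKerEquivOfSurjective _ hsurj)).symm⟩

theorem exists_smul_ne_zero_of_equiv_top (g : M ≃ₗ[S] Top S (leftIdeal e)) :
    ∃ t : M, e • t ≠ 0 := by
  refine ⟨g.symm (Submodule.Quotient.mk ⟨e, self_mem_leftIdeal e⟩), fun h => ?_⟩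
  rw [← map_smul, LinearEquiv.map_eq_zero_iff, ← Submodule.Quotient.mk_smul,
    Submodule.Quotient.mk_eq_zero] at h
  exact he.isCoatom_jacobson.1 (he.eq_top_of_mul_eq h (z := 1) (by simp [he.idem]))

/-- A local idempotent does not annihilate the top of the ring. -/
theorem exists_smul_top_ne_zero : ∃ t : Top S S, e • t ≠ 0 := by
  refine ⟨Submodule.Quotient.mk e, fun h => ?_⟩
  rw [← Submodule.Quotient.mk_smul, smul_eq_mul, he.idem, Submodule.Quotient.mk_eq_zero] at h
  have h1 := Module.map_jacobson_le (LinearMap.toSpanSingleton S (leftIdeal e)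
    ⟨e, self_mem_leftIdeal e⟩) (Submodule.mem_map_of_mem h)
  exact he.isCoatom_jacobson.1 (he.eq_top_of_mul_eq h1 (z := 1) (by simp [he.idem]))

/-- A nonzero idempotent in a local corner is the identity of the corner. -/
theorem eq_of_idem {a : S} (hea : e * a = a) (hae : a * e = a) (ha : a * a = a) (h0 : a ≠ 0) :
    a = e := by
  rcases he.exists_inv a (e - a) hea hae (by rw [mul_sub, he.idem, hea])
    (by rw [sub_mul, he.idem, hae]) (add_sub_cancel a e) with ⟨z, hz, -⟩ | ⟨z, hz, -⟩
  · calc a = e * a := hea.symm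
      _ = z * (a * a) := by rw [← hz, mul_assoc]
      _ = e := by rw [ha, hz]
  · refine absurd ?_ h0
    calc a = e * a := hea.symm
      _ = z * ((e - a) * a) := by rw [← mul_assoc, hz]
      _ = 0 := by rw [sub_mul, hea, ha, sub_self, mul_zero]

/-- Local idempotents with isomorphic tops generate isomorphic left ideals. -/
theorem nonempty_equiv_of_top_equiv (hf : IsCornerLocal f)
    (g : Top S (leftIdeal f) ≃ₗ[S] Top S (leftIdeal e)) :
    Nonempty (leftIdeal f ≃ₗ[S] leftIdeal e) := by
  obtain ⟨t, ht⟩ := he.exists_smul_ne_zero_of_equiv_top g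
  obtain ⟨w, rfl⟩ := Submodule.Quotient.mk_surjective _ t
  have hwf := (mem_leftIdeal hf.idem).mp w.2
  rw [← Submodule.Quotient.mk_smul, Ne, Submodule.Quotient.mk_eq_zero] at ht
  set x : S := e * w with hx
  have hxf : x * f = x := by rw [hx, mul_assoc, hwf]
  have hex : e * x = x := by rw [hx, ← mul_assoc, he.idem]
  -- `x` lies outside the only maximal submodule of `Sf`, so it generates `Sf`.
  have hrange : LinearMap.range (mulRight (e := e) hf.idem x hxf) = ⊤ := by
    by_contra hne
    have : Module.Finite S (leftIdeal f) := Module.Finite.span_singleton S f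
    obtain ⟨N, hN, hle⟩ := (eq_top_or_exists_le_coatom _).resolve_left hne
    refine ht ?_
    rw [hf.jacobson_eq hN]
    exact hle ⟨⟨e, self_mem_leftIdeal e⟩, Subtype.ext hex⟩
  obtain ⟨y, hy⟩ := LinearMap.range_eq_top.mp hrange ⟨f, self_mem_leftIdeal f⟩
  have hyx : (y : S) * x = f := congrArg Subtype.val hy
  have hye := (mem_leftIdeal he.idem).mp y.2
  -- From `yx = f`, this product is a nonzero idempotent of the local corner `eSe`.
  have hxy : x * (f * y) = e := by
    refine he.eq_of_idem ?_ ?_ ?_ ?_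
    · rw [← mul_assoc, hex]
    · rw [mul_assoc x, mul_assoc f, hye]
    · calc x * (f * y) * (x * (f * y)) = x * (f * (y * x) * f) * y := by simp only [mul_assoc]
        _ = x * (f * y) := by rw [hyx, hf.idem, hf.idem, mul_assoc]
    · intro h0
      refine hf.ne_zero ?_
      calc f = y * x * (f * y * x) := by rw [hyx, mul_assoc, hyx, hf.idem, hf.idem]
        _ = y * (x * (f * y)) * x := by simp only [mul_assoc]
        _ = 0 := by rw [h0, mul_zero, zero_mul]
  have hfyx : f * y * x = f := by rw [mul_assoc, hyx, hf.idem]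
  have hfye : f * y * e = f * y := by rw [mul_assoc, hye]
  refine ⟨LinearEquiv.ofLinearMap (mulRight he.idem (f * y) hfye) (mulRight hf.idem x hxf) ?_ ?_⟩
  · ext r
    simp only [LinearMap.comp_apply, coe_mulRight, LinearMap.id_apply]
    rw [mul_assoc, hxy, (mem_leftIdeal he.idem).mp r.2]
  · ext r
    simp only [LinearMap.comp_apply, coe_mulRight, LinearMap.id_apply]
    rw [mul_assoc, hfyx, (mem_leftIdeal hf.idem).mp r.2]

end IsCornerLocal

/-! ### Decomposition along a complete orthogonal family -/

section Complete

variable {ι : Type*} [Fintype ι] {e : ι → S}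

/-- The Peirce decomposition of a ring along a complete family of orthogonal idempotents. -/
def peirceEquiv (he : CompleteOrthogonalIdempotents e) : S ≃ₗ[S] Π i, leftIdeal (e i) where
  toFun x i := ⟨x * e i, (mem_leftIdeal (he.idem i)).mpr (by rw [mul_assoc, he.idem i])⟩
  map_add' x y := funext fun i => Subtype.ext (add_mul x y (e i))
  map_smul' a x := funext fun i => Subtype.ext (mul_assoc a x (e i))
  invFun y := ∑ i, (y i : S)
  left_inv x := by simp [← Finset.mul_sum, he.complete]
  right_inv y := by
    classical
    funext i
    refine Subtype.ext ?_
    change (∑ j, (y j : S)) * e i = y i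
    rw [Finset.sum_mul, Finset.sum_eq_single i]
    · exact (mem_leftIdeal (he.idem i)).mp (y i).2
    · intro j _ hj
      rw [← (mem_leftIdeal (he.idem j)).mp (y j).2, mul_assoc, he.ortho hj, mul_zero]
    · exact fun h => absurd (Finset.mem_univ i) h

/-- If the socle of `S` is isomorphic to its top, the products of the socles and of the tops of
the `Seᵢ` are isomorphic. -/
theorem nonempty_pi_socle_equiv_pi_top (he : CompleteOrthogonalIdempotents e)
    (h : Nonempty (socle S S ≃ₗ[S] Top S S)) :
    Nonempty ((Π i, socle S (leftIdeal (e i))) ≃ₗ[S] Π i, Top S (leftIdeal (e i))) := by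
  classical
  obtain ⟨g⟩ := h
  exact ⟨(((soclePiEquiv _).symm.trans (socleEquiv (peirceEquiv he)).symm).trans g).trans
    ((topEquiv (peirceEquiv he)).trans (topPiEquiv _))⟩

theorem isSimpleModule_socle_of_equiv_top (he : CompleteOrthogonalIdempotents e)
    (hloc : ∀ i, IsCornerLocal (e i)) (h : Nonempty (socle S S ≃ₗ[S] Top S S))
    (hne : ∀ i, socle S (leftIdeal (e i)) ≠ ⊥) (i : ι) :
    IsSimpleModule S (socle S (leftIdeal (e i))) := by
  obtain ⟨g⟩ := nonempty_pi_socle_equiv_pi_top he h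
  have (j : ι) : Nontrivial (socle S (leftIdeal (e j))) :=
    Submodule.nontrivial_iff_ne_bot.mpr (hne j)
  have (j : ι) : IsSimpleModule S (Top S (leftIdeal (e j))) := (hloc j).isSimpleModule_top
  exact isSimpleModule_of_pi_equiv g i

/-- The multiplicity of a simple module in the products of the socles and of the tops agree. -/
theorem card_socle_iso_eq_card_top_iso (he : CompleteOrthogonalIdempotents e)
    (hloc : ∀ i, IsCornerLocal (e i)) (h : Nonempty (socle S S ≃ₗ[S] Top S S))
    (hne : ∀ i, socle S (leftIdeal (e i)) ≠ ⊥) [IsSimpleModule S M] :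
    Nat.card {i // Nonempty (socle S (leftIdeal (e i)) ≃ₗ[S] M)} =
      Nat.card {i // Nonempty (Top S (leftIdeal (e i)) ≃ₗ[S] M)} := by
  obtain ⟨g⟩ := nonempty_pi_socle_equiv_pi_top he h
  have := isSimpleModule_socle_of_equiv_top he hloc h hne
  have (j : ι) : IsSimpleModule S (Top S (leftIdeal (e j))) := (hloc j).isSimpleModule_top
  exact card_iso_eq_of_pi_equiv g

/-- A nonzero `t` is the sum of the `eᵢt`, so some `eᵢ` does not annihilate `M`. -/
theorem exists_equiv_top (he : CompleteOrthogonalIdempotents e)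
    (hloc : ∀ i, IsCornerLocal (e i)) [IsSimpleModule S M] :
    ∃ i, Nonempty (M ≃ₗ[S] Top S (leftIdeal (e i))) := by
  have := IsSimpleModule.nontrivial S M
  obtain ⟨t, ht⟩ := exists_ne (0 : M)
  by_contra! hcon
  refine ht ?_
  rw [← one_smul S t, ← he.complete, Finset.sum_smul]
  refine Finset.sum_eq_zero fun i _ => ?_
  by_contra hi
  exact not_isEmpty_iff.mpr ((hloc i).nonempty_equiv_top hi) (hcon i)

end Complete

end Idempotents

/-- A class function on a finite type and a map of classes which preserves the number of members
induce a bijection of classes preserving the number of members. -/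
theorem exists_perm_of_card_fiber_eq {ι κ : Type*} [Finite ι] [Finite κ] (c : ι → κ) (σ : κ → κ)
    (hc : Function.Surjective c)
    (h : ∀ l, Nat.card {i // σ (c i) = l} = Nat.card {i // c i = l}) :
    ∃ π : Equiv.Perm κ, (∀ k, π k = σ k) ∧
      ∀ k, Nat.card {i // c i = k} = Nat.card {i // c i = π k} := by
  have hsurj : Function.Surjective σ := fun l => by
    obtain ⟨j, hj⟩ := hc l
    have hpos : 0 < Nat.card {i // σ (c i) = l} := by
      rw [h l]
      have : Nonempty {i // c i = l} := ⟨⟨j, hj⟩⟩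
      exact Nat.card_pos
    obtain ⟨⟨i, hi⟩⟩ := (Nat.card_pos_iff.mp hpos).1
    exact ⟨c i, hi⟩
  have hbij : Function.Bijective σ := ⟨Finite.injective_iff_surjective.mpr hsurj, hsurj⟩
  refine ⟨Equiv.ofBijective σ hbij, fun _ => rfl, fun k => ?_⟩
  -- By injectivity of `σ`, the fibre of `c` over `k` is that of `σ ∘ c` over `σ k`.
  rw [Equiv.ofBijective_apply, ← h (σ k)]
  exact Nat.card_congr (Equiv.subtypeEquivRight fun i => hbij.1.eq_iff.symm)

/-! ### Passage between right ideals and the opposite ring -/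

section Opposite

variable {R : Type*} [Ring R]

/-- `R` as a right module over itself is `Rᵐᵒᵖ` as a left module over itself. -/
def opEquiv (R : Type*) [Ring R] : R ≃ₗ[Rᵐᵒᵖ] Rᵐᵒᵖ where
  toFun := op
  map_add' _ _ := rfl
  map_smul' _ _ := rfl
  invFun := unop
  left_inv _ := rfl
  right_inv _ := rfl

/-- The right ideal `eR` of `R` is the left ideal of `Rᵐᵒᵖ` generated by `op e`. -/
def rightIdealEquiv (e : R) : rightIdeal e ≃ₗ[Rᵐᵒᵖ] leftIdeal (op e) :=
  ((opEquiv R).submoduleMap (rightIdeal e)).trans (LinearEquiv.ofEq _ _ (by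
    rw [rightIdeal, leftIdeal]
    erw [Submodule.map_span]
    rw [Set.image_singleton]
    rfl))

theorem mem_rightIdeal {e : R} (he : e * e = e) {x : R} : x ∈ rightIdeal e ↔ e * x = x := by
  rw [rightIdeal, Submodule.mem_span_singleton]
  refine ⟨?_, fun h => ⟨op x, h⟩⟩
  rintro ⟨a, rfl⟩
  rw [MulOpposite.smul_eq_mul_unop, ← mul_assoc, he]

theorem IsLocalIdempotent.isCornerLocal_op {e : R} (h : IsLocalIdempotent e) :
    IsCornerLocal (op e) := by
  refine .of_isLocalRing_end (unop_injective h.idem) ?_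
  have := h.isLocalRing_end
  let g := (rightIdealEquiv e).conjRingEquiv
  refine { toNontrivial := g.injective.nontrivial, isUnit_or_isUnit_of_add_one := ?_ }
  intro a b hab
  have h1 : g.symm a + g.symm b = 1 := by rw [← map_add, hab, map_one]
  exact (IsLocalRing.isUnit_or_isUnit_of_add_one h1).imp (isUnit_map_iff g.symm a).mp
    (isUnit_map_iff g.symm b).mp

theorem completeOrthogonalIdempotents_op {ι : Type*} [Fintype ι] {e : ι → R}
    (h : CompleteOrthogonalIdempotents e) :
    CompleteOrthogonalIdempotents fun i => op (e i) where
  idem i := unop_injective (h.idem i)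
  ortho i j hij := unop_injective (h.ortho hij.symm)
  complete := by rw [← op_one, ← h.complete, Finset.op_sum]

/-- The left socle is closed under right multiplication. -/
theorem mul_mem_socle {x : R} (hx : x ∈ socle R R) (r : R) : x * r ∈ socle R R :=
  map_mem_socle (LinearMap.toSpanSingleton R R r) hx

theorem socle_submodule_ne_bot_of_isEssential {S M : Type*} [Ring S] [AddCommGroup M] [Module S M]
    (h : IsEssential (socle S M)) {L : Submodule S M} (hL : L ≠ ⊥) : socle S L ≠ ⊥ := by
  obtain ⟨x, ⟨hx, hxL⟩, hx0⟩ := Submodule.exists_mem_ne_zero_of_ne_bot (h L hL)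
  exact fun hbot => hx0 (congrArg Subtype.val
    ((Submodule.mem_bot S).mp (hbot ▸ mem_socle_submodule_iff.mpr hx : (⟨x, hxL⟩ : L) ∈ ⊥)))

/-- If the right socle is essential, then a simple right socle of `eR` is contained in the left
socle as soon as `e` does not annihilate the left socle. -/
theorem mem_left_socle_of_mem_socle_rightIdeal (h : IsEssential (socle Rᵐᵒᵖ R)) {e : R}
    (he : e * e = e) [IsSimpleModule Rᵐᵒᵖ (socle Rᵐᵒᵖ (rightIdeal e))]
    (hne : ∃ t ∈ socle R R, e * t ≠ 0) {x : rightIdeal e}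
    (hx : x ∈ socle Rᵐᵒᵖ (rightIdeal e)) : (x : R) ∈ socle R R := by
  obtain ⟨t, ht, het⟩ := hne
  -- `K = eR ∩ S_l` is a right ideal containing `et ≠ 0`. By essentiality it contains a nonzero
  -- element of `soc(eR)`, which generates that simple module.
  let K : Submodule Rᵐᵒᵖ R :=
    { carrier := {y | y ∈ rightIdeal e ∧ y ∈ socle R R}
      add_mem' := fun ha hb => ⟨add_mem ha.1 hb.1, add_mem ha.2 hb.2⟩
      zero_mem' := ⟨zero_mem _, zero_mem _⟩
      smul_mem' := fun a y hy => ⟨Submodule.smul_mem _ a hy.1, mul_mem_socle hy.2 _⟩ }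
  have hK : K ≠ ⊥ := (Submodule.ne_bot_iff K).mpr ⟨e * t,
    ⟨(mem_rightIdeal he).mpr (by rw [← mul_assoc, he]), Submodule.smul_mem _ e ht⟩, het⟩
  obtain ⟨y, ⟨hys, hyK⟩, hy0⟩ := Submodule.exists_mem_ne_zero_of_ne_bot (h K hK)
  have hy : (⟨y, hyK.1⟩ : rightIdeal e) ∈ socle Rᵐᵒᵖ (rightIdeal e) :=
    mem_socle_submodule_iff.mpr hys
  obtain ⟨a, ha⟩ := IsSimpleModule.toSpanSingleton_surjective Rᵐᵒᵖ
    (m := (⟨⟨y, hyK.1⟩, hy⟩ : socle Rᵐᵒᵖ (rightIdeal e)))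
    (fun h0 => hy0 (congrArg (fun w : socle Rᵐᵒᵖ (rightIdeal e) => (w : R)) h0)) ⟨x, hx⟩
  have ha' : a • y = (x : R) := congrArg (fun w : socle Rᵐᵒᵖ (rightIdeal e) => (w : R)) ha
  rw [← ha']
  exact mul_mem_socle hyK.2 _

end Opposite

/-! ### The permutation and the left socles -/

section Main

variable {R : Type*} [Ring R]

theorem IsSemiperfect.exists_basicIdempotents (h : IsSemiperfect R) :
    ∃ m n : ℕ, Nonempty (BasicIdempotents R m n) := by
  obtain ⟨m, e, he, hloc⟩ := h
  let s : Setoid (Fin m) :=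
    { r := fun i j => Nonempty (rightIdeal (e i) ≃ₗ[Rᵐᵒᵖ] rightIdeal (e j))
      iseqv := ⟨fun _ => ⟨.refl _ _⟩, fun ⟨f⟩ => ⟨f.symm⟩, fun ⟨f⟩ ⟨g⟩ => ⟨f.trans g⟩⟩ }
  obtain ⟨n, ⟨q⟩⟩ := Finite.exists_equiv_fin (Quotient s)
  refine ⟨m, n, ⟨⟨e, he, hloc, fun k => (q.symm k).out, fun k l hkl => ?_, fun j => ?_⟩⟩⟩
  · exact q.symm.injective (Quotient.out_equiv_out.mp hkl)
  · refine ⟨q ⟦j⟧, ?_⟩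
    rw [q.symm_apply_apply]
    exact Quotient.mk_out (s := s) j

theorem nonempty_socle_op_equiv_top
    (hr : Nonempty (socle Rᵐᵒᵖ R ≃ₗ[Rᵐᵒᵖ] Top Rᵐᵒᵖ R)) :
    Nonempty (socle Rᵐᵒᵖ Rᵐᵒᵖ ≃ₗ[Rᵐᵒᵖ] Top Rᵐᵒᵖ Rᵐᵒᵖ) :=
  hr.map fun g => ((socleEquiv (opEquiv R)).symm.trans g).trans (topEquiv (opEquiv R))

theorem socle_leftIdeal_op_ne_bot {e : R} (h : socle Rᵐᵒᵖ (rightIdeal e) ≠ ⊥) :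
    socle Rᵐᵒᵖ (leftIdeal (op e)) ≠ ⊥ := by
  have := Submodule.nontrivial_iff_ne_bot.mpr h
  exact Submodule.nontrivial_iff_ne_bot.mp
    (socleEquiv (rightIdealEquiv e)).symm.toEquiv.nontrivial

namespace BasicIdempotents

variable {m n : ℕ} (B : BasicIdempotents R m n)

/-- The index of the basic idempotent representing the class of the `j`-th idempotent. -/
noncomputable def cls (j : Fin m) : Fin n := (B.exhaustive j).choose

theorem nonempty_equiv_cls (j : Fin m) :
    Nonempty (rightIdeal (B.basic (B.cls j)) ≃ₗ[Rᵐᵒᵖ] rightIdeal (B.e j)) :=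
  (B.exhaustive j).choose_spec

theorem cls_eq_iff (j : Fin m) (k : Fin n) :
    B.cls j = k ↔ Nonempty (rightIdeal (B.basic k) ≃ₗ[Rᵐᵒᵖ] rightIdeal (B.e j)) := by
  obtain ⟨f⟩ := B.nonempty_equiv_cls j
  constructor
  · rintro rfl
    exact ⟨f⟩
  · rintro ⟨g⟩
    exact B.irredundant _ _ ⟨f.trans g.symm⟩

theorem mult_eq_card (k : Fin n) : B.mult k = Nat.card {j // B.cls j = k} :=
  Nat.card_congr (Equiv.subtypeEquivRight fun j => (B.cls_eq_iff j k).symm)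

theorem cls_surjective : Function.Surjective B.cls := fun k =>
  ⟨B.idx k, (B.cls_eq_iff _ _).mpr ⟨.refl _ _⟩⟩

/-- The top determines `eⱼR` up to isomorphism, so counting simple modules counts classes of
idempotents. -/
theorem cls_eq_iff_top (j : Fin m) (k : Fin n) :
    B.cls j = k ↔
      Nonempty (Top Rᵐᵒᵖ (rightIdeal (B.e j)) ≃ₗ[Rᵐᵒᵖ] Top Rᵐᵒᵖ (rightIdeal (B.basic k))) := by
  rw [cls_eq_iff]
  constructor
  · rintro ⟨f⟩
    exact ⟨topEquiv f.symm⟩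
  · rintro ⟨g⟩
    obtain ⟨f⟩ := (B.isLocal j).isCornerLocal_op.nonempty_equiv_of_top_equiv
      (B.isLocal (B.idx k)).isCornerLocal_op
      (((topEquiv (rightIdealEquiv (B.basic k))).symm.trans g.symm).trans
        (topEquiv (rightIdealEquiv (B.e j))))
    exact ⟨((rightIdealEquiv _).trans f).trans (rightIdealEquiv _).symm⟩

theorem isSimpleModule_top (j : Fin m) :
    IsSimpleModule Rᵐᵒᵖ (Top Rᵐᵒᵖ (rightIdeal (B.e j))) := by
  have := (B.isLocal j).isCornerLocal_op.isSimpleModule_top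
  exact IsSimpleModule.congr (topEquiv (rightIdealEquiv (B.e j)))

variable (hr : Nonempty (socle Rᵐᵒᵖ R ≃ₗ[Rᵐᵒᵖ] Top Rᵐᵒᵖ R))
  (hne : ∀ j, socle Rᵐᵒᵖ (rightIdeal (B.e j)) ≠ ⊥)
include hr hne

theorem isSimpleModule_socle (j : Fin m) :
    IsSimpleModule Rᵐᵒᵖ (socle Rᵐᵒᵖ (rightIdeal (B.e j))) := by
  have := isSimpleModule_socle_of_equiv_top (completeOrthogonalIdempotents_op B.complete)
    (fun i => (B.isLocal i).isCornerLocal_op) (nonempty_socle_op_equiv_top hr)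
    (fun i => socle_leftIdeal_op_ne_bot (hne i)) j
  exact IsSimpleModule.congr (socleEquiv (rightIdealEquiv (B.e j)))

/-- The permutation of the basic idempotents given by the socles of the right ideals. -/
theorem exists_perm_socle_equiv_top : ∃ π : Equiv.Perm (Fin n),
    (∀ k, Nonempty (socle Rᵐᵒᵖ (rightIdeal (B.basic k)) ≃ₗ[Rᵐᵒᵖ]
      Top Rᵐᵒᵖ (rightIdeal (B.basic (π k))))) ∧ B.RespectsMultiplicities π := by
  have hsoc := B.isSimpleModule_socle hr hne
  have hop := completeOrthogonalIdempotents_op B.complete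
  have hloc := fun i => (B.isLocal i).isCornerLocal_op
  have hex : ∀ k, ∃ l, Nonempty (socle Rᵐᵒᵖ (rightIdeal (B.basic k)) ≃ₗ[Rᵐᵒᵖ]
      Top Rᵐᵒᵖ (rightIdeal (B.basic l))) := fun k => by
    have : IsSimpleModule Rᵐᵒᵖ (socle Rᵐᵒᵖ (rightIdeal (B.basic k))) := hsoc (B.idx k)
    obtain ⟨i, ⟨g⟩⟩ := exists_equiv_top (M := socle Rᵐᵒᵖ (rightIdeal (B.basic k))) hop hloc
    obtain ⟨f⟩ := (B.cls_eq_iff_top i _).mp rfl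
    exact ⟨B.cls i, ⟨(g.trans (topEquiv (rightIdealEquiv _)).symm).trans f⟩⟩
  choose σ hσ using hex
  have hiff : ∀ i l, σ (B.cls i) = l ↔ Nonempty (socle Rᵐᵒᵖ (leftIdeal (op (B.e i))) ≃ₗ[Rᵐᵒᵖ]
      Top Rᵐᵒᵖ (rightIdeal (B.basic l))) := fun i l => by
    obtain ⟨f⟩ := B.nonempty_equiv_cls i
    obtain ⟨g⟩ := hσ (B.cls i)
    let F := (socleEquiv (f.trans (rightIdealEquiv (B.e i)))).symm.trans g
    constructor
    · rintro rfl
      exact ⟨F⟩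
    · rintro ⟨G⟩
      -- Writes `σ (B.cls i)` as the class of its own basic idempotent, the form needed for
      -- `cls_eq_iff_top`.
      rw [← (B.cls_eq_iff _ _).mpr ⟨.refl _ (rightIdeal (B.basic (σ (B.cls i))))⟩]
      exact (B.cls_eq_iff_top _ _).mpr ⟨F.symm.trans G⟩
  obtain ⟨π, hπ, hmult⟩ := exists_perm_of_card_fiber_eq B.cls σ B.cls_surjective fun l => by
    have : IsSimpleModule Rᵐᵒᵖ (Top Rᵐᵒᵖ (rightIdeal (B.basic l))) :=
      B.isSimpleModule_top (B.idx l)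
    have hcard := card_socle_iso_eq_card_top_iso (M := Top Rᵐᵒᵖ (rightIdeal (B.basic l)))
      hop hloc (nonempty_socle_op_equiv_top hr) fun i => socle_leftIdeal_op_ne_bot (hne i)
    rw [Nat.card_congr (Equiv.subtypeEquivRight fun i => hiff i l), hcard]
    refine Nat.card_congr (Equiv.subtypeEquivRight fun i => ?_)
    rw [cls_eq_iff_top]
    exact ⟨fun ⟨f⟩ => ⟨(topEquiv (rightIdealEquiv (B.e i))).trans f⟩,
      fun ⟨f⟩ => ⟨(topEquiv (rightIdealEquiv (B.e i))).symm.trans f⟩⟩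
  refine ⟨π, fun k => ?_, fun k => ?_⟩
  · rw [hπ k]
    exact hσ k
  · rw [mult_eq_card, mult_eq_card]
    exact hmult k

end BasicIdempotents
end Main
theorem hasNakayamaPermutation_of_socle_equiv_top {R : Type*} [Ring R]
    (hR : IsSemiperfect R)
    (hess : IsEssential (socle Rᵐᵒᵖ R))
    (hsoc : ∀ e : R, IsLocalIdempotent e →
      socle R (leftIdeal e) ≠ ⊥)
    (hl : Nonempty (socle R R ≃ₗ[R] Top R R))
    (hr : Nonempty (socle Rᵐᵒᵖ R ≃ₗ[Rᵐᵒᵖ] Top Rᵐᵒᵖ R)) :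
    HasNakayamaPermutationRespectingMultiplicities R := by
  refine ⟨hR.exists_basicIdempotents, fun m n B => ?_⟩
  have hcl (j : Fin m) : IsCornerLocal (B.e j) := (B.isLocal j).isCornerLocal_op.of_op
  have hne (j : Fin m) : socle Rᵐᵒᵖ (rightIdeal (B.e j)) ≠ ⊥ :=
    socle_submodule_ne_bot_of_isEssential hess ((Submodule.ne_bot_iff _).mpr
      ⟨B.e j, Submodule.mem_span_singleton_self _, (hcl j).ne_zero⟩)
  have hsimple (j : Fin m) : IsSimpleModule R (socle R (leftIdeal (B.e j))) :=
    isSimpleModule_socle_of_equiv_top B.complete hcl hl (fun i => hsoc _ (B.isLocal i)) j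
  obtain ⟨π, hπ, hmult⟩ := B.exists_perm_socle_equiv_top hr hne
  refine ⟨π, fun k => ⟨hπ k, ?_⟩, hmult⟩
  have hidem : B.basic k * B.basic k = B.basic k := (hcl (B.idx k)).idem
  have hidem' : B.basic (π k) * B.basic (π k) = B.basic (π k) := (hcl (B.idx (π k))).idem
  obtain ⟨g⟩ := hπ k
  have hloc : IsCornerLocal (op (B.basic (π k))) := (B.isLocal (B.idx (π k))).isCornerLocal_op
  obtain ⟨t, ht⟩ := hloc.exists_smul_ne_zero_of_equiv_top
    (M := socle Rᵐᵒᵖ (rightIdeal (B.basic k)))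
    (g.trans (topEquiv (rightIdealEquiv (B.basic (π k)))))
  have : IsSimpleModule Rᵐᵒᵖ (socle Rᵐᵒᵖ (rightIdeal (B.basic k))) :=
    B.isSimpleModule_socle hr hne (B.idx k)
  obtain ⟨f⟩ := hl
  -- `eₖ` acts nontrivially on `R/J(R)`, hence on the isomorphic module `S_l`.
  obtain ⟨a, ha⟩ : ∃ a : socle R R, B.basic k • a ≠ 0 := by
    obtain ⟨b, hb⟩ := (hcl (B.idx k)).exists_smul_top_ne_zero
    refine ⟨f.symm b, fun h => hb ?_⟩
    rwa [← map_smul, LinearEquiv.map_eq_zero_iff] at h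
  have hleft : ((t : rightIdeal (B.basic k)) : R) ∈ socle R R :=
    mem_left_socle_of_mem_socle_rightIdeal hess hidem
      ⟨a, a.2, fun h => ha (Subtype.ext h)⟩ t.2
  -- `y` is a nonzero element of `eₖRe_{π(k)} ∩ S_l`, so it lies in `soc(Re_{π(k)})` and is fixed by
  -- `eₖ`.
  let y : R := ((t : rightIdeal (B.basic k)) : R) * B.basic (π k)
  have hy : y ≠ 0 := fun h => ht (Subtype.ext (Subtype.ext h))
  have hyk : B.basic k * y = y := by
    rw [← mul_assoc, (mem_rightIdeal hidem).mp (t : rightIdeal (B.basic k)).2]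
  have hyl : y ∈ leftIdeal (B.basic (π k)) :=
    (mem_leftIdeal hidem').mpr (by rw [mul_assoc, hidem'])
  have : IsSimpleModule R (socle R (leftIdeal (B.basic (π k)))) := hsimple (B.idx (π k))
  refine (hcl (B.idx k)).nonempty_equiv_top
    (t := (⟨⟨y, hyl⟩, mem_socle_submodule_iff.mpr (mul_mem_socle hleft _)⟩ :
      socle R (leftIdeal (B.basic (π k))))) fun h => hy ?_
  rw [← hyk]
  exact congrArg (fun w : socle R (leftIdeal (B.basic (π k))) => (w : R)) h

end NakayamaPerm

theorem mainTheorem8 {R : Type*} [Ring R]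
    (hR : NakayamaPerm.IsSemiperfect R)
    (hess : NakayamaPerm.IsEssential (NakayamaPerm.socle Rᵐᵒᵖ R))
    (hsoc : ∀ e : R, NakayamaPerm.IsLocalIdempotent e →
      NakayamaPerm.socle R (NakayamaPerm.leftIdeal e) ≠ ⊥)
    (hl : Nonempty (NakayamaPerm.socle R R ≃ₗ[R] NakayamaPerm.Top R R))
    (hr : Nonempty (NakayamaPerm.socle Rᵐᵒᵖ R ≃ₗ[Rᵐᵒᵖ] NakayamaPerm.Top Rᵐᵒᵖ R)) :
    NakayamaPerm.HasNakayamaPermutationRespectingMultiplicities R :=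
  NakayamaPerm.hasNakayamaPermutation_of_socle_equiv_top hR hess hsoc hl hr
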